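/- For every integer $t \ge 0$, let \[ \begin{aligned} R_t(x) = {} & x^{8t+15} + x^{8t+14} + x^{8t+11} - x^{8t+10} - x^{8t+8} + 2x^{6t+9} - x^{4t+15} - x^{4t+11} \\ & - x^{4t+9} + 2x^{4t+8} - 2x^{4t+7} + x^{4t+6} + x^{4t+4} + x^{4t} - 2x^{2t+6} + x^7 + x^5 - x^4 - x - 1 , \end{aligned} \] and for every integer $b \ge 1$ let $\Phi_b(x)$ denote the $b$-th cyclotomic polynomial. Then for every integer $t \ge 0$ and every integer $b \ge 3$, the polynomial $\Phi_b(x)$ does not divide $R_t(x)$ in $\mathbb{Q}[x]$. -/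

import Mathlib

/-- The polynomial `R_t(x)` with rational coefficients. -/
noncomputable def polyR (t : ℕ) : Polynomial ℚ :=
  let x : Polynomial ℚ := Polynomial.X
  x ^ (8 * t + 15) + x ^ (8 * t + 14) + x ^ (8 * t + 11) - x ^ (8 * t + 10) - x ^ (8 * t + 8)
    + 2 * x ^ (6 * t + 9) - x ^ (4 * t + 15) - x ^ (4 * t + 11) - x ^ (4 * t + 9)
    + 2 * x ^ (4 * t + 8) - 2 * x ^ (4 * t + 7) + x ^ (4 * t + 6) + x ^ (4 * t + 4)
    + x ^ (4 * t) - 2 * x ^ (2 * t + 6) + x ^ 7 + x ^ 5 - x ^ 4 - x - 1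

/-! Write R_t(x) = P(x, x^(2t)) with P = `curveP` independent of t. If Φ_b divides R_t, then P(x^k,
x^(2tk)) = 0 for every k coprime to b, and this remains true for a root x of Φ_b in any commutative
ring, in particular in characteristic p (`curveP_eq_zero_of_cyclotomic_dvd`). Conjugates thus give
several equations in x and y = x^(2t); eliminating y bounds the order of x, uniformly in t. For b
odd, k = 1, 2, 4 put (x, y), (x^2, y^2), (x^4, y^4) on the curve. Eliminating y^2 between P(x,
y)P(x, -y) and P(x^2, y^2) gives D(x) = 0, and likewise D(x^2) = 0; a second elimination makes x a
root of unity of explicit order. Characteristic p only controls the part of b prime to p, so p = 3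
and p = 5 are combined. For b = 2o with o odd, the same argument applies to -x and leaves only b =
6, excluded modulo 7. For 4 | b, the exponent 1 + b/2 sends x to -x and fixes y, so the even and odd
parts of P in x both vanish; eliminating y modulo 3 and using one more conjugate forces x^2 = 1. The
eliminations are explicit Bézout identities modulo p, checked by Kronecker substitution on large
integers. -/

open Polynomial

/-! ### Polynomials as coefficient lists -/

section CoefficientLists

/-- Sum of two coefficient lists. -/
def addCoeffs : List ℕ → List ℕ → List ℕ
  | [], m => m
  | a :: l, [] => a :: l
  | a :: l, b :: m => (a + b) :: addCoeffs l m

/-- Product of two coefficient lists. -/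
def mulCoeffs : List ℕ → List ℕ → List ℕ
  | [], _ => []
  | a :: l, m => addCoeffs (m.map (a * ·)) (0 :: mulCoeffs l m)

/-- Substitution of the polynomial `q` into a coefficient list. -/
def compCoeffs (q : List ℕ) : List ℕ → List ℕ
  | [] => []
  | a :: l => addCoeffs [a] (mulCoeffs q (compCoeffs q l))

/-- Sum of two bivariate polynomials, given as lists of coefficient lists. -/
def addRows : List (List ℕ) → List (List ℕ) → List (List ℕ)
  | [], m => m
  | a :: l, [] => a :: l
  | a :: l, b :: m => addCoeffs a b :: addRows l m

/-- Product of two bivariate polynomials. -/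
def mulRows : List (List ℕ) → List (List ℕ) → List (List ℕ)
  | [], _ => []
  | a :: l, m => addRows (m.map (mulCoeffs a)) ([] :: mulRows l m)

/-- The entries of even index. -/
def evenRows : List (List ℕ) → List (List ℕ)
  | [] => []
  | [a] => [a]
  | a :: _ :: l => a :: evenRows l

/-- The entries of odd index. -/
def oddRows : List (List ℕ) → List (List ℕ)
  | [] => []
  | [_] => []
  | _ :: b :: l => b :: oddRows l

/-- The list of the `k` lowest decimal digits of `n`. -/
def digitList : ℕ → ℕ → List ℕ
  | 0, _ => []
  | k + 1, n => n % 10 :: digitList k (n / 10)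

/-- The value of a coefficient list at a natural number. -/
def packCoeffs (z : ℕ) : List ℕ → ℕ
  | [] => 0
  | a :: l => a + z * packCoeffs z l

/-- Kronecker substitution: the values of all coefficient lists at `z`. -/
def packRows (z : ℕ) (l : List (List ℕ)) : List ℕ :=
  l.map (packCoeffs z)

/-- The number `n` has at most `k` digits in base `z`, all divisible by `p`. -/
def digitsVanish (p z : ℕ) : ℕ → ℕ → Bool
  | 0, n => n == 0
  | k + 1, n => n == 0 || (n % z % p == 0 && digitsVanish p z k (n / z))

/-- A sufficient condition for all coefficients of a bivariate polynomial to be divisible by `p`,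
in terms of its Kronecker substitutions `S z`. -/
def packVanishes (p : ℕ) (S : ℕ → List ℕ) : Bool :=
  ((S 1).all fun n => n < 2 ^ 256) && (S (2 ^ 256)).all (digitsVanish p (2 ^ 256) 1024)

/-- The Kronecker substitution of `A * F + B * G + H`, in terms of those of `F` and `G`. -/
def packBezout (A B H : List (List ℕ)) (F G : ℕ → List ℕ) (z : ℕ) : List ℕ :=
  addCoeffs (addCoeffs (mulCoeffs (packRows z A) (F z)) (mulCoeffs (packRows z B) (G z)))
    (packRows z H)

/-- The coefficient list of `x ^ a * (x ^ (n + 1) - 1)` modulo `15`. -/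
def unityCoeffs (a n : ℕ) : List ℕ :=
  List.replicate a 0 ++ 14 :: (List.replicate n 0 ++ [1])

/-! ### Evaluation of coefficient lists, and its compatibility with the list operations. -/

variable {K : Type*}

section Semiring

variable [CommSemiring K]

/-- Evaluation of a coefficient list. -/
def evalCoeffs (x : K) : List ℕ → K
  | [] => 0
  | a :: l => a + x * evalCoeffs x l

/-- Evaluation of a list of coefficient lists. -/
def evalRows (x y : K) : List (List ℕ) → K
  | [] => 0
  | r :: l => evalCoeffs x r + y * evalRows x y l

variable (x y : K)

theorem evalCoeffs_add (l m : List ℕ) :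
    evalCoeffs x (addCoeffs l m) = evalCoeffs x l + evalCoeffs x m := by
  induction l generalizing m with
  | nil => simp [addCoeffs, evalCoeffs]
  | cons a l ih =>
    cases m with
    | nil => simp [addCoeffs, evalCoeffs]
    | cons b m => simp only [addCoeffs, evalCoeffs, ih]; push_cast; ring

theorem evalCoeffs_map_mul (a : ℕ) (l : List ℕ) :
    evalCoeffs x (l.map (a * ·)) = a * evalCoeffs x l := by
  induction l with
  | nil => simp [evalCoeffs]
  | cons b l ih => simp only [List.map_cons, evalCoeffs, ih]; push_cast; ring

theorem evalCoeffs_mul (l m : List ℕ) :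
    evalCoeffs x (mulCoeffs l m) = evalCoeffs x l * evalCoeffs x m := by
  induction l with
  | nil => simp [mulCoeffs, evalCoeffs]
  | cons a l ih =>
    simp only [mulCoeffs, evalCoeffs_add, evalCoeffs_map_mul, evalCoeffs, ih]; push_cast; ring

theorem evalCoeffs_comp (q l : List ℕ) :
    evalCoeffs x (compCoeffs q l) = evalCoeffs (evalCoeffs x q) l := by
  induction l with
  | nil => simp [compCoeffs, evalCoeffs]
  | cons a l ih => simp [compCoeffs, evalCoeffs, evalCoeffs_add, evalCoeffs_mul, ih]

theorem evalRows_add (l m : List (List ℕ)) :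
    evalRows x y (addRows l m) = evalRows x y l + evalRows x y m := by
  induction l generalizing m with
  | nil => simp [addRows, evalRows]
  | cons a l ih =>
    cases m with
    | nil => simp [addRows, evalRows]
    | cons b m => simp only [addRows, evalRows, ih, evalCoeffs_add]; ring

theorem evalRows_map_mul (a : List ℕ) (l : List (List ℕ)) :
    evalRows x y (l.map (mulCoeffs a)) = evalCoeffs x a * evalRows x y l := by
  induction l with
  | nil => simp [evalRows]
  | cons b l ih => simp only [List.map_cons, evalRows, ih, evalCoeffs_mul]; ring

theorem evalRows_mul (l m : List (List ℕ)) :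
    evalRows x y (mulRows l m) = evalRows x y l * evalRows x y m := by
  induction l with
  | nil => simp [mulRows, evalRows]
  | cons a l ih =>
    simp only [mulRows, evalRows_add, evalRows_map_mul, evalRows, evalCoeffs, ih]; ring

theorem evalRows_map_comp (q : List ℕ) (l : List (List ℕ)) :
    evalRows x y (l.map (compCoeffs q)) = evalRows (evalCoeffs x q) y l := by
  induction l with
  | nil => simp [evalRows]
  | cons a l ih => simp [evalRows, evalCoeffs_comp, ih]

theorem evalRows_singleton (r : List ℕ) : evalRows x y [r] = evalCoeffs x r := by
  simp [evalRows]

theorem evalRows_evenRows_add_oddRows : ∀ l : List (List ℕ),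
    evalRows x (y ^ 2) (evenRows l) + y * evalRows x (y ^ 2) (oddRows l) = evalRows x y l
  | [] => by simp [evenRows, oddRows, evalRows]
  | [a] => by simp [evenRows, oddRows, evalRows]
  | a :: b :: l => by
    simp only [evenRows, oddRows, evalRows, ← evalRows_evenRows_add_oddRows l]; ring

/-! ### Kronecker substitution. -/

theorem packCoeffs_eq_evalCoeffs (z : ℕ) (l : List ℕ) : packCoeffs z l = evalCoeffs z l := by
  induction l with
  | nil => rfl
  | cons a l ih => simp [packCoeffs, evalCoeffs, ih]

theorem packRows_addRows (z : ℕ) (l m : List (List ℕ)) :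
    packRows z (addRows l m) = addCoeffs (packRows z l) (packRows z m) := by
  induction l generalizing m with
  | nil => simp [addRows, packRows, addCoeffs]
  | cons a l ih =>
    cases m with
    | nil => simp [addRows, packRows, addCoeffs]
    | cons b m =>
      simpa [addRows, packRows, addCoeffs, packCoeffs_eq_evalCoeffs, evalCoeffs_add] using ih m

theorem packRows_mulRows (z : ℕ) (l m : List (List ℕ)) :
    packRows z (mulRows l m) = mulCoeffs (packRows z l) (packRows z m) := by
  induction l with
  | nil => simp [mulRows, packRows, mulCoeffs]
  | cons a l ih =>
    have h : packRows z (m.map (mulCoeffs a)) =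
        (packRows z m).map (packCoeffs z a * ·) := by
      simp [packRows, packCoeffs_eq_evalCoeffs, evalCoeffs_mul]
    have h' : packRows z ([] :: mulRows l m) = 0 :: packRows z (mulRows l m) := rfl
    rw [mulRows, packRows_addRows, h, h', ih]
    rfl

/-- Substituting q before packing at z amounts to packing at q(z), so certificates never expand a
composed polynomial. -/
theorem packRows_map_comp (z : ℕ) (q : List ℕ) (l : List (List ℕ)) :
    packRows z (l.map (compCoeffs q)) = packRows (packCoeffs z q) l := by
  simp [packRows, packCoeffs_eq_evalCoeffs, evalCoeffs_comp]

/-- Packing at 1 is the sum of the coefficients, so one number bounds them all and rules out carries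
in a larger base. -/
theorem le_packCoeffs_one {a : ℕ} {l : List ℕ} (ha : a ∈ l) : a ≤ packCoeffs 1 l := by
  induction l with
  | nil => simp at ha
  | cons b l ih =>
    rcases List.mem_cons.1 ha with rfl | ha
    · simp [packCoeffs]
    · have := ih ha
      simp only [packCoeffs]
      omega

/-- When all entries are below z, they are exactly the base-z digits of the packed number. -/
theorem mod_eq_zero_of_digitsVanish {p z : ℕ} {l : List ℕ} (hl : ∀ a ∈ l, a < z) {k : ℕ}
    (h : digitsVanish p z k (packCoeffs z l) = true) : ∀ a ∈ l, a % p = 0 := by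
  induction l generalizing k with
  | nil => simp
  | cons b l ih =>
    have hb : b < z := hl b (by simp)
    have hl' : ∀ a ∈ l, a < z := fun a ha => hl a (by simp [ha])
    suffices h' : b % p = 0 ∧ ∃ k, digitsVanish p z k (packCoeffs z l) = true by
      obtain ⟨hbp, k, hk⟩ := h'
      intro a ha
      rcases List.mem_cons.1 ha with rfl | ha
      · exact hbp
      · exact ih hl' hk a ha
    -- The digit test stops early at 0; the remaining entries are then all zero, and fuel 0 suffices
    -- for the tail.
    have hzero (h0 : packCoeffs z (b :: l) = 0) :
        b % p = 0 ∧ ∃ k, digitsVanish p z k (packCoeffs z l) = true := by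
      simp only [packCoeffs, Nat.add_eq_zero_iff, Nat.mul_eq_zero] at h0
      exact ⟨by simp [h0.1], 0, by simp [digitsVanish, h0.2.resolve_left (by omega)]⟩
    cases k with
    | zero => exact hzero (by simpa [digitsVanish] using h)
    | succ k =>
      simp only [digitsVanish, Bool.or_eq_true, Bool.and_eq_true, beq_iff_eq] at h
      rcases h with h | ⟨h1, h2⟩
      · exact hzero h
      · rw [packCoeffs, Nat.add_mul_mod_self_left, Nat.mod_eq_of_lt hb] at h1
        rw [packCoeffs, Nat.add_mul_div_left _ _ (by omega), Nat.div_eq_of_lt hb, zero_add] at h2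
        exact ⟨h1, k, h2⟩

end Semiring

/-! ### Bézout certificates and elimination in characteristic p. -/

variable [CommRing K] {x y : K}

theorem evalCoeffs_eq_zero {p : ℕ} [CharP K p] {l : List ℕ} (h : ∀ a ∈ l, a % p = 0) :
    evalCoeffs x l = 0 := by
  induction l with
  | nil => rfl
  | cons a l ih =>
    have ha : (a : K) = 0 :=
      (CharP.cast_eq_zero_iff K p a).2 (Nat.dvd_of_mod_eq_zero (h a (by simp)))
    simp [evalCoeffs, ha, ih fun b hb => h b (by simp [hb])]

theorem evalRows_eq_zero_of_packVanishes {p : ℕ} [CharP K p] {l : List (List ℕ)}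
    (h : packVanishes p (packRows · l) = true) : evalRows x y l = 0 := by
  have h' : ∀ r ∈ l, ∀ a ∈ r, a % p = 0 := by
    simp only [packVanishes, packRows, List.all_map, Bool.and_eq_true, List.all_eq_true,
      Function.comp_apply, decide_eq_true_eq] at h
    exact fun r hr => mod_eq_zero_of_digitsVanish
      (fun a ha => (le_packCoeffs_one ha).trans_lt (h.1 r hr)) (h.2 r hr)
  clear h
  induction l with
  | nil => rfl
  | cons r l ih =>
    simp [evalRows, evalCoeffs_eq_zero (h' r (by simp)), ih fun s hs => h' s (by simp [hs])]

theorem evalCoeffs_replicate_append (a : ℕ) (l : List ℕ) :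
    evalCoeffs x (List.replicate a 0 ++ l) = x ^ a * evalCoeffs x l := by
  induction a with
  | zero => simp
  | succ a ih =>
    simp only [List.replicate_succ, List.cons_append, evalCoeffs, ih]; push_cast; ring

theorem evalCoeffs_unityCoeffs (h15 : (15 : K) = 0) (a n : ℕ) :
    evalCoeffs x (unityCoeffs a n) = x ^ a * (x ^ (n + 1) - 1) := by
  simp only [unityCoeffs, evalCoeffs_replicate_append, evalCoeffs]
  push_cast
  linear_combination x ^ a * h15

/-- A Bézout identity modulo `p` transports common zeros. -/
theorem evalRows_eq_zero_of_bezout (p : ℕ) [CharP K p] {A B F G H : List (List ℕ)}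
    (h : packVanishes p (packBezout A B H (packRows · F) (packRows · G)) = true)
    (hF : evalRows x y F = 0) (hG : evalRows x y G = 0) : evalRows x y H = 0 := by
  have h' : packVanishes p
      (packRows · (addRows (addRows (mulRows A F) (mulRows B G)) H)) = true := by
    simp only [packRows_addRows, packRows_mulRows]
    exact h
  simpa [evalRows_add, evalRows_mul, hF, hG] using
    evalRows_eq_zero_of_packVanishes (x := x) (y := y) h'

/-- A univariate Bézout identity certifying that the common zeros of `D` and `D ∘ q`
are roots of unity. -/
theorem pow_eq_one_of_bezout [IsDomain K] (p : ℕ) [CharP K p] (h15 : (15 : K) = 0)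
    {D U V q : List ℕ} {a n : ℕ}
    (h : packVanishes p (packBezout [U] [V] [unityCoeffs a n] (packRows · [D])
      fun z => packRows (packCoeffs z q) [D]) = true)
    (hx : x ≠ 0) (h₁ : evalCoeffs x D = 0) (h₂ : evalCoeffs (evalCoeffs x q) D = 0) :
    x ^ (n + 1) = 1 := by
  simp only [← packRows_map_comp] at h
  -- A single row does not involve y, so its value is arbitrary.
  have key := evalRows_eq_zero_of_bezout (x := x) (y := 0) p h (by rwa [evalRows_singleton])
    (by rwa [evalRows_map_comp, evalRows_singleton])
  rw [evalRows_singleton, evalCoeffs_unityCoeffs h15] at key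
  exact sub_eq_zero.1 ((mul_eq_zero.1 key).resolve_left (pow_ne_zero _ hx))

/-- The polynomial `P(x, y) P(x, -y)` modulo `15`, as a polynomial in `x` and `y ^ 2`. -/
def normRows (P : List (List ℕ)) : List (List ℕ) :=
  addRows (mulRows (evenRows P) (evenRows P))
    ([] :: mulRows [[14]] (mulRows (oddRows P) (oddRows P)))

/-- The Kronecker substitution of `normRows P`. -/
def packNorm (P : List (List ℕ)) (z : ℕ) : List ℕ :=
  addCoeffs (mulCoeffs (packRows z (evenRows P)) (packRows z (evenRows P)))
    (0 :: mulCoeffs [14] (mulCoeffs (packRows z (oddRows P)) (packRows z (oddRows P))))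

theorem packRows_normRows (P : List (List ℕ)) (z : ℕ) :
    packRows z (normRows P) = packNorm P z := by
  have h (l : List (List ℕ)) : packRows z ([] :: l) = 0 :: packRows z l := rfl
  simp only [normRows, packNorm, packRows_addRows, h, packRows_mulRows]
  simp [packRows, packCoeffs]

/-- With P = E + yO, the product with the conjugate E - yO is E^2 - y^2 O^2. The coefficient 14
stands for -1, serving p = 3 and p = 5 at once. -/
theorem evalRows_normRows (h15 : (15 : K) = 0) {P : List (List ℕ)} (h : evalRows x y P = 0) :
    evalRows x (y ^ 2) (normRows P) = 0 := by
  rw [← evalRows_evenRows_add_oddRows] at h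
  simp only [normRows, evalRows_add, evalRows_mul, evalRows, evalCoeffs]
  push_cast
  linear_combination (evalRows x (y ^ 2) (evenRows P) - y * evalRows x (y ^ 2) (oddRows P)) * h +
    y ^ 2 * evalRows x (y ^ 2) (oddRows P) ^ 2 * h15

/-- Elimination of `y` from `P(x, y) = P(x ^ 2, y ^ 2) = P(x ^ 4, y ^ 4) = 0`. -/
theorem pow_eq_one_of_certificate [IsDomain K] (p : ℕ) [CharP K p] (h15 : (15 : K) = 0)
    {P A B : List (List ℕ)} {D U V : List ℕ} {a n : ℕ}
    (h : packVanishes p (packBezout A B [D] (packNorm P)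
      fun z => packRows (packCoeffs z [0, 0, 1]) P) = true)
    (h' : packVanishes p (packBezout [U] [V] [unityCoeffs a n] (packRows · [D])
      fun z => packRows (packCoeffs z [0, 0, 1]) [D]) = true)
    (hx : x ≠ 0) (h₁ : evalRows x y P = 0) (h₂ : evalRows (x ^ 2) (y ^ 2) P = 0)
    (h₄ : evalRows ((x ^ 2) ^ 2) ((y ^ 2) ^ 2) P = 0) : x ^ (n + 1) = 1 := by
  have sq (z : K) : evalCoeffs z [0, 0, 1] = z ^ 2 := by simp [evalCoeffs]; ring
  have h'' : packVanishes p (packBezout A B [D] (packRows · (normRows P))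
      (packRows · (P.map (compCoeffs [0, 0, 1])))) = true := by
    simpa only [packRows_normRows, packRows_map_comp] using h
  have step {u v : K} (hu : evalRows u v P = 0) (hv : evalRows (u ^ 2) (v ^ 2) P = 0) :
      evalCoeffs u D = 0 := by
    rw [← evalRows_singleton u (v ^ 2)]
    exact evalRows_eq_zero_of_bezout p h'' (evalRows_normRows h15 hu)
      (by rwa [evalRows_map_comp, sq])
  exact pow_eq_one_of_bezout p h15 h' hx (step h₁ h₂) (by rw [sq]; exact step h₂ h₄)

end CoefficientLists

/-! ### The curve containing the points `(x, x ^ (2 * t))` -/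

section Curve

variable {K : Type*} [CommRing K]

/-- The bivariate polynomial with `R_t(x) = P(x, x ^ (2 * t))`. -/
def curveP (x y : K) : K :=
  y ^ 4 * (x ^ 15 + x ^ 14 + x ^ 11 - x ^ 10 - x ^ 8) + 2 * y ^ 3 * x ^ 9
    + y ^ 2 * (-x ^ 15 - x ^ 11 - x ^ 9 + 2 * x ^ 8 - 2 * x ^ 7 + x ^ 6 + x ^ 4 + 1)
    - 2 * y * x ^ 6 + (x ^ 7 + x ^ 5 - x ^ 4 - x - 1)

/-- The coefficients of `P(x, y)` modulo `15`. -/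
def curveRows : List (List ℕ) :=
  [[14, 14, 0, 0, 14, 1, 0, 1], [0, 0, 0, 0, 0, 0, 13],
    [1, 0, 0, 0, 1, 0, 1, 13, 2, 14, 0, 14, 0, 0, 0, 14], [0, 0, 0, 0, 0, 0, 0, 0, 0, 2],
    [0, 0, 0, 0, 0, 0, 0, 0, 14, 0, 14, 1, 0, 0, 1, 1]]

/-- The coefficients of `P(-x, y)` modulo `15`. -/
def negCurveRows : List (List ℕ) :=
  [[14, 1, 0, 0, 14, 14, 0, 14], [0, 0, 0, 0, 0, 0, 13],
    [1, 0, 0, 0, 1, 0, 1, 2, 2, 1, 0, 1, 0, 0, 0, 1], [0, 0, 0, 0, 0, 0, 0, 0, 0, 13],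
    [0, 0, 0, 0, 0, 0, 0, 0, 14, 0, 14, 14, 0, 0, 1, 14]]

/-- The part of `P(x, y)` even in `x`, as a polynomial in `x ^ 2` and `y`, modulo `15`. -/
def curveEvenRows : List (List ℕ) :=
  [[14, 0, 14], [0, 0, 0, 13], [1, 0, 1, 1, 2], [], [0, 0, 0, 0, 14, 14, 0, 1]]

/-- The part of `P(x, y)` odd in `x`, divided by `x`, as a polynomial in `x ^ 2` and `y`,
modulo `15`. -/
def curveOddRows : List (List ℕ) :=
  [[14, 0, 1, 1], [], [0, 0, 0, 13, 14, 14, 0, 14], [0, 0, 0, 0, 2], [0, 0, 0, 0, 0, 1, 0, 1]]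

theorem evalRows_curveRows (h15 : (15 : K) = 0) (x y : K) :
    evalRows x y curveRows = curveP x y := by
  have h14 : (14 : K) = -1 := by linear_combination h15
  have h13 : (13 : K) = -2 := by linear_combination h15
  simp only [curveRows, curveP, evalRows, evalCoeffs]
  push_cast
  rw [h14, h13]
  ring

theorem evalRows_negCurveRows (h15 : (15 : K) = 0) (x y : K) :
    evalRows x y negCurveRows = curveP (-x) y := by
  have h14 : (14 : K) = -1 := by linear_combination h15
  have h13 : (13 : K) = -2 := by linear_combination h15
  simp only [negCurveRows, curveP, evalRows, evalCoeffs]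
  push_cast
  rw [h14, h13]
  ring

theorem two_mul_evalRows_curveEvenRows (h15 : (15 : K) = 0) (x y : K) :
    2 * evalRows (x ^ 2) y curveEvenRows = curveP x y + curveP (-x) y := by
  have h14 : (14 : K) = -1 := by linear_combination h15
  have h13 : (13 : K) = -2 := by linear_combination h15
  simp only [curveEvenRows, curveP, evalRows, evalCoeffs]
  push_cast
  rw [h14, h13]
  ring

theorem two_mul_evalRows_curveOddRows (h15 : (15 : K) = 0) (x y : K) :
    2 * x * evalRows (x ^ 2) y curveOddRows = curveP x y - curveP (-x) y := by
  have h14 : (14 : K) = -1 := by linear_combination h15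
  have h13 : (13 : K) = -2 := by linear_combination h15
  simp only [curveOddRows, curveP, evalRows, evalCoeffs]
  push_cast
  rw [h14, h13]
  ring

end Curve

/-! ### Bézout certificates -/

/-- Cofactor of the norm of `P(x, y)` modulo `3`. -/
def curveThreeLeft : List (List ℕ) :=
  [2021111002111211110102000102211222221101222011122012020011122112111010110011222000210211211111211112112121220020121101011002000211101212201021212000110010212,
    202120012222221102212112012200200020201221220011221222101220002010112021201102000202010112010012020101021102211020002112102002110022101021002202001220120001201001012,
    1022210011110010100112100021222102221221200202022100200121211122222201200101220202011111102002020012001020012021101200012121112202011001022210000000000000000,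
    102222121002210122010102202210020111010022000200201222120101201211011212120011201112201212220210212100210000221210201101101201100012221021210012120210000000000000000].map (digitList 165)

/-- Cofactor of the dilation of `P(x, y)` modulo `3`. -/
def curveThreeRight : List (List ℕ) :=
  [1000202100210001120212220011112112000002000122102200100110211100121201201000011001220102112002022001212122000102020121020022200121112002111121211112121222022,
    202100210102012110022021102200222122122202111122112220010020102220020212002220020012011201200102002002212111200121201110002201020200100110202212201020021022011122021,
    222012022021200201211100002220122002020221012112001011022200201012012200010221211210021202102001120121220221121100021202022201212020002101012200220110112012100000000,
    211212220211200200122112021001022101122122201222020021201201021200001000100020222111211211110100201121100120210221121201001122201012212210020121012210000000000000000].map (digitList 165)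

/-- The eliminant of `P(x, y)` modulo `3`. -/
def curveThreeResultant : List ℕ :=
  digitList 167
    22102010010001201102202222210201202111122221202012011012202220220011211010111002200022001110101121100220222022101102102021222211112021020122222022011021000100102012200

/-- Cofactor of the eliminant of `P(x, y)` modulo `3`. -/
def curveThreeBezoutLeft : List ℕ :=
  digitList 318
    201211012102212111011211111002221101022000202202211201001221000010001200101210100012010202121202211010200222112020022000200212010200000001100202020122210111020022221111001221111000102001201011020012120122210210100120011220101021222021201100000102002211121211102120101210002101001001202021122202011020111202111000021212

/-- Cofactor of the dilated eliminant of `P(x, y)` modulo `3`. -/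
def curveThreeBezoutRight : List ℕ :=
  digitList 152
    11020211112121221000011002101101222101022102111211122221100202212122002200201221021110211122000211000220012010200210002122102210120000002110010111100112

/-- Cofactor of the norm of `P(-x, y)` modulo `3`. -/
def negCurveThreeLeft : List (List ℕ) :=
  [20211212221210021111210210101221010120102202101001111222102020102212112100112012001020102222120021001010221000200222221021102102200221011122000102,
    2021201221110101022111020201200211001102121201102100012120120110011011002122110011110001111122121211101210022210001020000011211102011100202200110210000102,
    10020221100212000210000020121210121121011201012122220102000222020100012202222112110220121022022222100210111021002110211100110201010000000000000000,
    1002011121002111112022122002022022200201001012221221121021121110221202201022211101211102022202112201111001011010221102200212211002200102010000000000000000].map (digitList 154)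

/-- Cofactor of the dilation of `P(-x, y)` modulo `3`. -/
def negCurveThreeRight : List (List ℕ) :=
  [20021112011020010000122110000121001121021222100200020220122010110012011121000122220022220121001200122200002122200121000001010001221011202200011122,
    1012000000002101221002001210000222010222100100201110101021201201200221121202110100102200000211101001200201112202111201110102210212202210010020102000020201,
    1211122211211011122111012101011120020212112122110211211010110012222200202120222001202010212120220200220012211022012021100220002121002212200020100100000000,
    1120000020001021110111101100120100102111001012201000020011220122101120220022120021011022210222210021101010122122111022102000021222210221010000000000000000].map (digitList 154)

/-- The eliminant of `P(-x, y)` modulo `3`. -/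
def negCurveThreeResultant : List ℕ :=
  digitList 156
    211221002012021110010212110112120102021221202001020020202000010110010012102222220121001001101000020202002010020212212020102121101121201001112021020012211200

/-- Cofactor of the eliminant of `P(-x, y)` modulo `3`. -/
def negCurveThreeBezoutLeft : List ℕ :=
  digitList 300
    102202201211111022221122010221000001201110122000100101112001202101022211020221002221100200000022211012000212220002102210202220010020221021211120011101121122101111112222010021201011010012111210120110200102212120100010111012220001002100110002221021222200101200000020221221122002211121102212012202121022

/-- Cofactor of the dilated eliminant of `P(-x, y)` modulo `3`. -/
def negCurveThreeBezoutRight : List ℕ :=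
  digitList 145
    2110001010112020202012002102111211202101202200020012122202020220022000120001110200120211122022120121210211002110111002001020211121122211222021221

/-- Cofactor of the norm of `P(x, y)` modulo `5`. -/
def curveFiveLeft : List (List ℕ) :=
  [3201342423202022403203110332232440322224330341103434342414203312434101122422332332132443331020311221300103002140103431203410003011410001120022322232431,
    320100030044132000131420132112444111012200243230224330103300042103022343400203234330400401202242233240002423410222442203140331304311210211211034432020301320331,
    2322110013341443221203022240122020030213313221110041302323102201104020300042213444023441422414224030041412441110304414110311211040243240000000000000000,
    232204020220322304033100302303133423311212323210024222320324340322401224403231122401433332314132320242023421124134133110421334100413204324202240000000000000000].map (digitList 159)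

/-- Cofactor of the dilation of `P(x, y)` modulo `5`. -/
def curveFiveRight : List (List ℕ) :=
  [2341224013342240100321203431031120431102130220341242204123223432212302334132440434021222031003141044124224244130433211324202122203443113422243410434301,
    320114124434012023233124340404430201113104142331411040440311124310042003243120020431010041032112404421432042103340212111043001014130404244222134344404031110224,
    401312430220134442004034102243143012403231100403320034140340103044241304313144242302020444114332211002034200010004204233212304140101332420001110411431200000000,
    332330401040202422243432041130414300022011410230423144142111344312243222131444232214111113340044333130023012410343214100204213230143331442210240000000000000000].map (digitList 159)

/-- The eliminant of `P(x, y)` modulo `5`. -/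
def curveFiveResultant : List ℕ :=
  digitList 161
    43032124244340400411130104343100232424022213024203220102224242303324411244114143424304333140332414210003214444022230440121033441004302311200434000143312013231300

/-- Cofactor of the eliminant of `P(x, y)` modulo `5`. -/
def curveFiveBezoutLeft : List ℕ :=
  digitList 310
    2121041421143123404442022112032201101000234014033334323201233423103304034203432222122402034144142230133031044214224420204204033414341402120023140432012212022034230040200301043414231111143411424024104033302001413301120014434112204131403240211412320102131323331414333442042200123211411323314323423241324442333212

/-- Cofactor of the dilated eliminant of `P(x, y)` modulo `5`. -/
def curveFiveBezoutRight : List ℕ :=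
  digitList 150
    300104202443020124030221223142224340000431121321214030333233020231334314132404002340022411123212420430110102123112133104144000034204333112034443442044

/-- Cofactor of the norm of `P(-x, y)` modulo `5`. -/
def negCurveFiveLeft : List (List ℕ) :=
  [3204433131323212422043440331434313042004113233303424431203434102331312201440323221001131304222421021000332000132400101030240312200001033320142,
    320413430021204001343313130400010242030424121301342430120442210124412142123140123441343234434200101031232100020432341423130031044230322142340332320142,
    2333021434000431042132004104032334444333200401341033022240223421134342112430144000300024404322024143404310301322202440203420130000000000000000,
    233341204320301344022120132144021032020414442024313004132224433323033020333321123414431310423014202241232243042211133011311311303104130000000000000000].map (digitList 150)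

/-- Cofactor of the dilation of `P(-x, y)` modulo `5`. -/
def negCurveFiveRight : List (List ℕ) :=
  [3214210031213024040020410432333430240222413320422132044024103132230003413422310132320410303131124333211002413113422121410212041010212142213302,
    230133033211121332443134102024032430004322220002331431123421141203011421204211022222140241103330243034011411122441112411432014013111340200104212440413,
    131312303034004114140002104321301313113133430222014321411020043122000232012001143140410323432432344243404001432412241042141004331240200413213400000000,
    241411222113043212011113240044440312003023422420120413314440200111143100044320341324042002004144442234233031120312331024332134022130130000000000000000].map (digitList 150)

/-- The eliminant of `P(-x, y)` modulo `5`. -/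
def negCurveFiveResultant : List ℕ :=
  digitList 152
    44431444423424144440034410324044424431213332121041423222234424102333413304141022412223041311233332314104343222434211311101320411200111141312311114211100

/-- Cofactor of the eliminant of `P(-x, y)` modulo `5`. -/
def negCurveFiveBezoutLeft : List ℕ :=
  digitList 286
    2424414143004433004114230020121041403214140413343412230143132131210232012320121200311313234144433212012210420111213434102031042201140104404442003030241010222001424011103321111303321142332044232432100004122120213214332102432421120122434122420204330102042011122233140403430211421331343241

/-- Cofactor of the dilated eliminant of `P(-x, y)` modulo `5`. -/
def negCurveFiveBezoutRight : List ℕ :=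
  digitList 135
    344223242311141330231041432413312242000231211002143331140130114104032234443241134121104141121411430344013104023433302302140433030240143

/-- Cofactor of the even part of `P(x, y)` modulo `3`. -/
def parityLeft : List (List ℕ) :=
  [20211202221001012002000000012001000,
    201002210202121122010202211011020000,
    10010110220022200202010021000100000,
    102211112112012222011010202000000000].map (digitList 36)

/-- Cofactor of the odd part of `P(x, y)` modulo `3`. -/
def parityRight : List (List ℕ) :=
  [1212102112002020021110121001002,
    112212022211002112220012102010000,
    20102220222011121121111020102110000,
    200211102100221002110011102200000000].map (digitList 36)

/-- The eliminant of the even and odd parts of `P(x, y)` modulo `3`. -/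
def parityResultant : List ℕ :=
  digitList 37
    2010002021100012022202100011202000102

/-- Cofactor of the eliminant, for the substitution `-X`. -/
def parityNegLeft : List ℕ :=
  digitList 36
    120120110020120202100021011112100022

/-- Cofactor of the substituted eliminant, for the substitution `-X`. -/
def parityNegRight : List ℕ :=
  digitList 36
    210210220222210202212221022121021220

/-- Cofactor of the eliminant, for the substitution `-X ^ 2`. -/
def parityNegSqLeft : List ℕ :=
  digitList 72
    101210111110110100122210001201020012222011012200220022121200220112212110

/-- Cofactor of the substituted eliminant, for the substitution `-X ^ 2`. -/
def parityNegSqRight : List ℕ :=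
  digitList 36
    200122200110222022112102121221022202

/-! ### Verification of the certificates -/

/-- The certificate for eliminating Y = y^2 between the norm of P and P(x^2, Y). Only x is packed,
so the kernel works with short lists of large integers. -/
theorem curveThree_elimination : packVanishes 3 (packBezout curveThreeLeft curveThreeRight [curveThreeResultant]
    (packNorm curveRows) fun z => packRows (packCoeffs z [0, 0, 1]) curveRows) = true := by
  decide +kernel

/-- The target is x^2 (x^54 - 1). The eliminant is itself divisible by x^2, so that factor is
unavoidable; it is harmless for x ≠ 0. -/
theorem curveThree_bezout : packVanishes 3 (packBezout [curveThreeBezoutLeft] [curveThreeBezoutRight]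
    [unityCoeffs 2 53] (packRows · [curveThreeResultant])
    fun z => packRows (packCoeffs z [0, 0, 1]) [curveThreeResultant]) = true := by
  decide +kernel

theorem curveFive_elimination : packVanishes 5 (packBezout curveFiveLeft curveFiveRight [curveFiveResultant]
    (packNorm curveRows) fun z => packRows (packCoeffs z [0, 0, 1]) curveRows) = true := by
  decide +kernel

theorem curveFive_bezout : packVanishes 5 (packBezout [curveFiveBezoutLeft] [curveFiveBezoutRight]
    [unityCoeffs 2 49] (packRows · [curveFiveResultant])
    fun z => packRows (packCoeffs z [0, 0, 1]) [curveFiveResultant]) = true := by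
  decide +kernel

theorem negCurveThree_elimination : packVanishes 3 (packBezout negCurveThreeLeft negCurveThreeRight [negCurveThreeResultant]
    (packNorm negCurveRows) fun z => packRows (packCoeffs z [0, 0, 1]) negCurveRows) = true := by
  decide +kernel

theorem negCurveThree_bezout : packVanishes 3 (packBezout [negCurveThreeBezoutLeft] [negCurveThreeBezoutRight]
    [unityCoeffs 2 17] (packRows · [negCurveThreeResultant])
    fun z => packRows (packCoeffs z [0, 0, 1]) [negCurveThreeResultant]) = true := by
  decide +kernel

theorem negCurveFive_elimination : packVanishes 5 (packBezout negCurveFiveLeft negCurveFiveRight [negCurveFiveResultant]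
    (packNorm negCurveRows) fun z => packRows (packCoeffs z [0, 0, 1]) negCurveRows) = true := by
  decide +kernel

theorem negCurveFive_bezout : packVanishes 5 (packBezout [negCurveFiveBezoutLeft] [negCurveFiveBezoutRight]
    [unityCoeffs 2 29] (packRows · [negCurveFiveResultant])
    fun z => packRows (packCoeffs z [0, 0, 1]) [negCurveFiveResultant]) = true := by
  decide +kernel

theorem parity_elimination : packVanishes 3 (packBezout parityLeft parityRight [parityResultant]
    (packRows · curveEvenRows) (packRows · curveOddRows)) = true := by
  decide +kernel

theorem parityNeg_bezout : packVanishes 3 (packBezout [parityNegLeft] [parityNegRight]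
    [unityCoeffs 0 0] (packRows · [parityResultant])
    fun z => packRows (packCoeffs z [0, 14]) [parityResultant]) = true := by
  decide +kernel

theorem parityNegSq_bezout : packVanishes 3 (packBezout [parityNegSqLeft] [parityNegSqRight]
    [unityCoeffs 0 0] (packRows · [parityResultant])
    fun z => packRows (packCoeffs z [0, 0, 14]) [parityResultant]) = true := by
  decide +kernel

/-! ### Orders of the points whose conjugates lie on the curve. -/

section Elimination

variable {K : Type*} [CommRing K] [IsDomain K] {x y : K}

theorem pow_eq_one_of_curveP_char_three [CharP K 3] (h15 : (15 : K) = 0) (hx : x ≠ 0)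
    (h₁ : curveP x y = 0) (h₂ : curveP (x ^ 2) (y ^ 2) = 0)
    (h₄ : curveP ((x ^ 2) ^ 2) ((y ^ 2) ^ 2) = 0) : x ^ 54 = 1 := by
  rw [← evalRows_curveRows h15] at h₁ h₂ h₄
  exact pow_eq_one_of_certificate 3 h15 curveThree_elimination curveThree_bezout hx h₁ h₂ h₄

theorem pow_eq_one_of_curveP_char_five [CharP K 5] (h15 : (15 : K) = 0) (hx : x ≠ 0)
    (h₁ : curveP x y = 0) (h₂ : curveP (x ^ 2) (y ^ 2) = 0)
    (h₄ : curveP ((x ^ 2) ^ 2) ((y ^ 2) ^ 2) = 0) : x ^ 50 = 1 := by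
  rw [← evalRows_curveRows h15] at h₁ h₂ h₄
  exact pow_eq_one_of_certificate 5 h15 curveFive_elimination curveFive_bezout hx h₁ h₂ h₄

theorem pow_eq_one_of_curveP_neg_char_three [CharP K 3] (h15 : (15 : K) = 0) (hx : x ≠ 0)
    (h₁ : curveP (-x) y = 0) (h₂ : curveP (-x ^ 2) (y ^ 2) = 0)
    (h₄ : curveP (-(x ^ 2) ^ 2) ((y ^ 2) ^ 2) = 0) : x ^ 18 = 1 := by
  rw [← evalRows_negCurveRows h15] at h₁ h₂ h₄
  exact pow_eq_one_of_certificate 3 h15 negCurveThree_elimination negCurveThree_bezout hx h₁ h₂ h₄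

theorem pow_eq_one_of_curveP_neg_char_five [CharP K 5] (h15 : (15 : K) = 0) (hx : x ≠ 0)
    (h₁ : curveP (-x) y = 0) (h₂ : curveP (-x ^ 2) (y ^ 2) = 0)
    (h₄ : curveP (-(x ^ 2) ^ 2) ((y ^ 2) ^ 2) = 0) : x ^ 30 = 1 := by
  rw [← evalRows_negCurveRows h15] at h₁ h₂ h₄
  exact pow_eq_one_of_certificate 5 h15 negCurveFive_elimination negCurveFive_bezout hx h₁ h₂ h₄

/-- The sum and difference of P(x, y) and P(-x, y) isolate the even and odd parts in x, both
polynomials in x^2 and y, from which y is eliminated. -/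
theorem evalCoeffs_parityResultant [CharP K 3] (h15 : (15 : K) = 0) (hx : x ≠ 0)
    (h : curveP x y = 0) (h' : curveP (-x) y = 0) :
    evalCoeffs (x ^ 2) parityResultant = 0 := by
  -- Uses 8 · 2 - 15 = 1.
  have h2 : (2 : K) ≠ 0 := fun h2 => one_ne_zero (α := K) (by linear_combination 8 * h2 - h15)
  have he := two_mul_evalRows_curveEvenRows h15 x y
  have ho := two_mul_evalRows_curveOddRows h15 x y
  rw [h, h', add_zero] at he
  rw [h, h', sub_zero] at ho
  rw [← evalRows_singleton (x ^ 2) y]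
  exact evalRows_eq_zero_of_bezout 3 parity_elimination
    ((mul_eq_zero.1 he).resolve_left h2) ((mul_eq_zero.1 ho).resolve_left (mul_ne_zero h2 hx))

theorem eq_one_of_parityResultant_neg [CharP K 3] (h15 : (15 : K) = 0) (hx : x ≠ 0)
    (h : evalCoeffs x parityResultant = 0) (h' : evalCoeffs (-x) parityResultant = 0) :
    x = 1 := by
  have e : evalCoeffs x [0, 14] = -x := by
    simp only [evalCoeffs]; push_cast; linear_combination x * h15
  simpa using pow_eq_one_of_bezout 3 h15 parityNeg_bezout hx h (by rwa [e])

theorem eq_one_of_parityResultant_neg_sq [CharP K 3] (h15 : (15 : K) = 0) (hx : x ≠ 0)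
    (h : evalCoeffs x parityResultant = 0) (h' : evalCoeffs (-x ^ 2) parityResultant = 0) :
    x = 1 := by
  have e : evalCoeffs x [0, 0, 14] = -x ^ 2 := by
    simp only [evalCoeffs]; push_cast; linear_combination x ^ 2 * h15
  simpa using pow_eq_one_of_bezout 3 h15 parityNegSq_bezout hx h (by rwa [e])

end Elimination

/-! ### Roots of cyclotomic polynomials in positive characteristic -/

section Cyclotomic

variable {K : Type*} [CommRing K] {x : K} {b : ℕ}

/-- An integral polynomial relation satisfied by a complex primitive `b`-th root of unity holds
for every root of the `b`-th cyclotomic polynomial. -/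
theorem aeval_eq_zero_of_isRoot_cyclotomic (hb : 0 < b) {f : ℤ[X]} {μ : ℂ}
    (hμ : IsPrimitiveRoot μ b) (hf : aeval μ f = 0) (hx : (cyclotomic b K).IsRoot x) :
    aeval x f = 0 := by
  have hdvd : cyclotomic b ℤ ∣ f := by
    rw [cyclotomic_eq_minpoly hμ hb]
    exact minpoly.isIntegrallyClosed_dvd (hμ.isIntegral hb) hf
  obtain ⟨g, rfl⟩ := hdvd
  have h0 : aeval x (cyclotomic b ℤ) = 0 := by
    rw [← eval_map_algebraMap, map_cyclotomic]; exact hx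
  rw [map_mul, h0, zero_mul]

theorem aeval_curveP (z : K) (k n : ℕ) :
    aeval z (curveP (X ^ k) ((X ^ k) ^ n) : ℤ[X]) = curveP (z ^ k) ((z ^ k) ^ n) := by
  have h2 : aeval z (2 : ℤ[X]) = 2 := map_ofNat _ 2
  simp [curveP, h2]

/-- Over ℂ, μ^k is again a primitive b-th root, hence a zero of R_t. As a relation on μ this has
integer coefficients, so it passes to x. -/
theorem curveP_eq_zero_of_cyclotomic_dvd (hb : 0 < b) {t k : ℕ}
    (h : cyclotomic b ℚ ∣ polyR t) (hx : (cyclotomic b K).IsRoot x) (hk : k.Coprime b) :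
    curveP (x ^ k) ((x ^ k) ^ (2 * t)) = 0 := by
  have hμ := Complex.isPrimitiveRoot_exp b hb.ne'
  set μ := Complex.exp (2 * Real.pi * Complex.I / b)
  rw [← aeval_curveP]
  refine aeval_eq_zero_of_isRoot_cyclotomic hb hμ ?_ hx
  rw [aeval_curveP]
  obtain ⟨g, hg⟩ := h
  have h1 := congrArg (aeval (μ ^ k)) hg
  have h0 : aeval (μ ^ k) (cyclotomic b ℚ) = 0 := by
    rw [← eval_map_algebraMap, map_cyclotomic]
    exact (hμ.pow_of_coprime k hk).isRoot_cyclotomic hb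
  rw [map_mul, h0, zero_mul] at h1
  rw [← h1]
  have h2 : aeval (μ ^ k) (2 : ℚ[X]) = 2 := map_ofNat _ 2
  simp only [curveP, polyR, map_add, map_sub, map_mul, map_pow, aeval_X, map_one, h2]
  ring

/-- Transferred from ℂ, since x itself need not be a primitive root of unity in positive
characteristic. -/
theorem pow_half_eq_neg_one {c : ℕ} (hc : 0 < c) (hx : (cyclotomic (2 * c) K).IsRoot x) :
    x ^ c = -1 := by
  have hμ := Complex.isPrimitiveRoot_exp (2 * c) (by omega)
  set μ := Complex.exp (2 * Real.pi * Complex.I / (2 * c : ℕ))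
  have h := aeval_eq_zero_of_isRoot_cyclotomic (f := X ^ c + 1) (by omega) hμ ?_ hx
  · simpa [eq_neg_iff_add_eq_zero] using h
  · have h2 : (μ ^ c) ^ 2 = 1 := by rw [← pow_mul, mul_comm]; exact hμ.pow_eq_one
    have h1 : μ ^ c ≠ 1 := hμ.pow_ne_one_of_pos_of_lt hc.ne' (by omega)
    simp [(mul_self_eq_one_iff.1 ((sq _).symm.trans h2)).resolve_left h1]

theorem isRoot_cyclotomic_ne_zero [Nontrivial K] (hb : 0 < b) (hx : (cyclotomic b K).IsRoot x) :
    x ≠ 0 := by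
  rintro rfl
  have h := aeval_eq_zero_of_isRoot_cyclotomic (f := X ^ b - 1) hb
    (Complex.isPrimitiveRoot_exp b hb.ne')
    (by simp [(Complex.isPrimitiveRoot_exp b hb.ne').pow_eq_one]) hx
  simp [hb.ne'] at h

/-- For b = p^k m with p ∤ m, a root of Φ_b in characteristic p is a primitive m-th root of unity,
so m divides n. -/
theorem exists_dvd_prime_pow_mul [IsDomain K] (p : ℕ) [Fact p.Prime] [CharP K p] (hb : 0 < b)
    (hx : (cyclotomic b K).IsRoot x) {n : ℕ} (hn : x ^ n = 1) : ∃ k, b ∣ p ^ k * n := by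
  obtain ⟨k, m, hm, rfl⟩ :=
    Nat.exists_eq_pow_mul_and_not_dvd hb.ne' p (Fact.out : p.Prime).ne_one
  have : NeZero (m : K) := ⟨fun h => hm ((CharP.cast_eq_zero_iff K p m).1 h)⟩
  exact ⟨k, mul_dvd_mul_left _
    ((isRoot_cyclotomic_prime_pow_mul_iff_of_charP.1 hx).dvd_of_pow_eq_one _ hn)⟩

theorem exists_isRoot_cyclotomic (p : ℕ) [Fact p.Prime] (hb : 0 < b) :
    ∃ x : AlgebraicClosure (ZMod p), (cyclotomic b (AlgebraicClosure (ZMod p))).IsRoot x :=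
  IsAlgClosed.exists_root _ (degree_cyclotomic_pos b _ hb).ne'

end Cyclotomic

/-! ### The three congruence classes -/

theorem eq_one_of_odd {b t : ℕ} (hodd : Odd b) (h : cyclotomic b ℚ ∣ polyR t) : b = 1 := by
  have hb := hodd.pos
  have zeros {K : Type} [CommRing K] {x : K} (hx : (cyclotomic b K).IsRoot x) :
      curveP x (x ^ (2 * t)) = 0 ∧ curveP (x ^ 2) ((x ^ (2 * t)) ^ 2) = 0 ∧
        curveP ((x ^ 2) ^ 2) (((x ^ (2 * t)) ^ 2) ^ 2) = 0 := by
    have h2 : Nat.Coprime 2 b := Nat.coprime_two_left.2 hodd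
    have e1 := curveP_eq_zero_of_cyclotomic_dvd (k := 1) hb h hx (Nat.coprime_one_left b)
    have e2 := curveP_eq_zero_of_cyclotomic_dvd (k := 2) hb h hx h2
    have e4 := curveP_eq_zero_of_cyclotomic_dvd (k := 2 * 2) hb h hx (h2.mul_left h2)
    exact ⟨by simpa using e1, by rwa [pow_right_comm] at e2,
      by rwa [pow_right_comm, pow_mul, pow_mul (x ^ (2 * t))] at e4⟩
  have : Fact (Nat.Prime 5) := ⟨by norm_num⟩
  obtain ⟨x, hx⟩ := exists_isRoot_cyclotomic 3 hb
  obtain ⟨z, hz⟩ := exists_isRoot_cyclotomic 5 hb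
  have hx15 : (15 : AlgebraicClosure (ZMod 3)) = 0 := by
    exact_mod_cast (CharP.cast_eq_zero_iff _ 3 15).2 (by norm_num)
  have hz15 : (15 : AlgebraicClosure (ZMod 5)) = 0 := by
    exact_mod_cast (CharP.cast_eq_zero_iff _ 5 15).2 (by norm_num)
  obtain ⟨x1, x2, x4⟩ := zeros hx
  obtain ⟨z1, z2, z4⟩ := zeros hz
  obtain ⟨k, hk⟩ := exists_dvd_prime_pow_mul 3 hb hx
    (pow_eq_one_of_curveP_char_three hx15 (isRoot_cyclotomic_ne_zero hb hx) x1 x2 x4)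
  obtain ⟨j, hj⟩ := exists_dvd_prime_pow_mul 5 hb hz
    (pow_eq_one_of_curveP_char_five hz15 (isRoot_cyclotomic_ne_zero hb hz) z1 z2 z4)
  -- The exponents 54 = 2 · 27 and 50 = 2 · 25 share only the factor 2, which is prime to b.
  have hcop : Nat.Coprime (3 ^ k * 27) (5 ^ j * 25) :=
    Nat.Coprime.mul_left (Nat.Coprime.mul_right (Nat.Coprime.pow _ _ (by norm_num))
      (Nat.Coprime.pow_left _ (by norm_num)))
      (Nat.Coprime.mul_right (Nat.Coprime.pow_right _ (by norm_num)) (by norm_num))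
  have hb2 : Nat.Coprime b 2 := Nat.coprime_two_right.2 hodd
  have hk' : b ∣ 3 ^ k * 27 := hb2.dvd_of_dvd_mul_right (by rwa [mul_assoc])
  have hj' : b ∣ 5 ^ j * 25 := hb2.dvd_of_dvd_mul_right (by rwa [mul_assoc])
  exact Nat.eq_one_of_dvd_coprimes hcop hk' hj'

theorem not_dvd_six (t : ℕ) : ¬ cyclotomic 6 ℚ ∣ polyR t := by
  intro h
  -- 3 is a primitive root modulo 7; y = 3^(2t) is then a cube root of unity, leaving finitely many
  -- y to test for all t.
  have hx : (cyclotomic 6 (ZMod 7)).IsRoot 3 := by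
    have : Fact (Nat.Prime 7) := ⟨by norm_num⟩
    have : NeZero ((6 : ℕ) : ZMod 7) := ⟨by decide +revert⟩
    rw [isRoot_cyclotomic_iff, IsPrimitiveRoot.iff (by norm_num)]
    refine ⟨by decide +revert, fun l hl hl' => ?_⟩
    interval_cases l <;> decide +revert
  have h0 := curveP_eq_zero_of_cyclotomic_dvd (k := 1) (by norm_num) h hx (by norm_num)
  have hy : (((3 : ZMod 7) ^ 1) ^ (2 * t)) ^ 3 = 1 := by
    rw [← pow_mul, ← pow_mul, show 1 * (2 * t * 3) = 6 * t by ring, pow_mul]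
    rw [show (3 : ZMod 7) ^ 6 = 1 by decide, one_pow]
  have key : ∀ y : ZMod 7, y ^ 3 = 1 → curveP ((3 : ZMod 7) ^ 1) y ≠ 0 := by
    unfold curveP; decide
  exact key _ hy h0

theorem eq_one_of_two_mul_odd {o t : ℕ} (hodd : Odd o) (h : cyclotomic (2 * o) ℚ ∣ polyR t) :
    o = 1 := by
  have ho := hodd.pos
  have hb : 0 < 2 * o := by omega
  have zeros {K : Type} [CommRing K] {x : K} (hx : (cyclotomic (2 * o) K).IsRoot x) :
      curveP (- -x) (x ^ (2 * t)) = 0 ∧ curveP (-(-x) ^ 2) ((x ^ (2 * t)) ^ 2) = 0 ∧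
        curveP (-((-x) ^ 2) ^ 2) (((x ^ (2 * t)) ^ 2) ^ 2) = 0 := by
    -- 2 and 4 are not prime to 2o, but 2 + o and 4 + o are. As x^o = -1, they give -x^2 and -x^4,
    -- and the even exponent 2t removes the sign from y.
    have hcop (k : ℕ) (hk : Nat.Coprime k o) (hk2 : Odd (k + o)) :
        Nat.Coprime (k + o) (2 * o) :=
      Nat.Coprime.mul_right (Nat.coprime_two_right.2 hk2) (by simpa using hk)
    have h2 : Nat.Coprime 2 o := Nat.coprime_two_left.2 hodd
    have hneg := pow_half_eq_neg_one ho hx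
    have e1 := curveP_eq_zero_of_cyclotomic_dvd (k := 1) hb h hx (Nat.coprime_one_left _)
    have e2 := curveP_eq_zero_of_cyclotomic_dvd hb h hx
      (hcop 2 h2 (Even.add_odd (by decide) hodd))
    have e4 := curveP_eq_zero_of_cyclotomic_dvd hb h hx
      (hcop (2 * 2) (h2.mul_left h2) (Even.add_odd (by decide) hodd))
    rw [pow_add, hneg, mul_neg_one, neg_pow, pow_mul (-1 : K), neg_one_sq, one_pow,
      one_mul] at e2 e4
    refine ⟨by simpa using e1, ?_, ?_⟩
    · rw [neg_sq]
      rwa [pow_right_comm] at e2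
    · rw [neg_sq]
      rwa [pow_right_comm, pow_mul, pow_mul (x ^ (2 * t))] at e4
  have : Fact (Nat.Prime 5) := ⟨by norm_num⟩
  obtain ⟨x, hx⟩ := exists_isRoot_cyclotomic 3 hb
  obtain ⟨z, hz⟩ := exists_isRoot_cyclotomic 5 hb
  have hx15 : (15 : AlgebraicClosure (ZMod 3)) = 0 := by
    exact_mod_cast (CharP.cast_eq_zero_iff _ 3 15).2 (by norm_num)
  have hz15 : (15 : AlgebraicClosure (ZMod 5)) = 0 := by
    exact_mod_cast (CharP.cast_eq_zero_iff _ 5 15).2 (by norm_num)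
  obtain ⟨x1, x2, x4⟩ := zeros hx
  obtain ⟨z1, z2, z4⟩ := zeros hz
  have hx18 := pow_eq_one_of_curveP_neg_char_three hx15
    (neg_ne_zero.2 (isRoot_cyclotomic_ne_zero hb hx)) x1 x2 x4
  have hz30 := pow_eq_one_of_curveP_neg_char_five hz15
    (neg_ne_zero.2 (isRoot_cyclotomic_ne_zero hb hz)) z1 z2 z4
  rw [Even.neg_pow (by decide)] at hx18 hz30
  obtain ⟨k, hk⟩ := exists_dvd_prime_pow_mul 3 hb hx hx18
  obtain ⟨j, hj⟩ := exists_dvd_prime_pow_mul 5 hb hz hz30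
  have ho2 : Nat.Coprime o 2 := Nat.coprime_two_right.2 hodd
  have hk' : o ∣ 3 ^ k * 9 :=
    ho2.dvd_of_dvd_mul_right (by rw [mul_assoc]; exact (dvd_mul_left o 2).trans hk)
  have hj' : o ∣ 5 ^ j * 15 :=
    ho2.dvd_of_dvd_mul_right (by rw [mul_assoc]; exact (dvd_mul_left o 2).trans hj)
  -- The bound from p = 3 makes o prime to 5, so the bound from p = 5 reduces to o ∣ 3.
  have ho5 : Nat.Coprime o 5 := Nat.Coprime.coprime_dvd_left hk'
    (Nat.Coprime.mul_left (Nat.Coprime.pow_left _ (by norm_num)) (by norm_num))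
  have ho3 : o ∣ 3 := ho5.dvd_of_dvd_mul_right
    (show o ∣ 3 * 5 from (Nat.Coprime.pow_right j ho5).dvd_of_dvd_mul_left hj')
  rcases (Nat.dvd_prime Nat.prime_three).1 ho3 with rfl | rfl
  · rfl
  · exact absurd h (not_dvd_six t)

theorem not_dvd_of_four_dvd {c t : ℕ} (hc : 0 < c) : ¬ cyclotomic (4 * c) ℚ ∣ polyR t := by
  intro h
  have hb : 0 < 4 * c := by omega
  obtain ⟨x, hx⟩ := exists_isRoot_cyclotomic 3 hb
  have h15 : (15 : AlgebraicClosure (ZMod 3)) = 0 := by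
    exact_mod_cast (CharP.cast_eq_zero_iff _ 3 15).2 (by norm_num)
  have hx0 := isRoot_cyclotomic_ne_zero hb hx
  have hhalf : x ^ (2 * c) = -1 := pow_half_eq_neg_one (by omega) (by rwa [← mul_assoc])
  have hres (k : ℕ) (hk : k.Coprime (4 * c)) :
      evalCoeffs ((x ^ k) ^ 2) parityResultant = 0 := by
    have hk2 : Odd k := Nat.coprime_two_right.1 (hk.coprime_dvd_right ⟨2 * c, by ring⟩)
    -- Since x^(2c) = -1 and k is odd, this exponent replaces x^k by -x^k without changing y.
    have hcop : Nat.Coprime (k * (1 + 2 * c)) (4 * c) := by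
      refine hk.mul_left (Nat.Coprime.mul_right ?_ ?_)
      · exact Nat.Coprime.pow_right (k := 1 + 2 * c) (m := 2) 2
          (Nat.coprime_two_right.2 (by simp))
      · simp
    have e1 := curveP_eq_zero_of_cyclotomic_dvd hb h hx hk
    have e2 := curveP_eq_zero_of_cyclotomic_dvd hb h hx hcop
    have hneg : x ^ (k * (1 + 2 * c)) = -x ^ k := by
      rw [mul_add, pow_add, mul_one, mul_comm k (2 * c), pow_mul x (2 * c), hhalf,
        hk2.neg_one_pow, mul_neg_one]
    rw [hneg, Even.neg_pow (even_two_mul t)] at e2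
    exact evalCoeffs_parityResultant h15 (pow_ne_zero _ hx0) e1 e2
  have h1 := hres 1 (Nat.coprime_one_left _)
  rw [pow_one] at h1
  -- A further conjugate of x^2 is needed. For c even, 1 + c is prime to 4c and gives -x^2; for c
  -- odd, 2 + c is, and gives -x^4.
  have hx2 : x ^ 2 = 1 := by
    rcases Nat.even_or_odd c with hc2 | hc2
    · have e := hres (1 + c) (Nat.Coprime.mul_right
        (Nat.Coprime.pow_right (k := 1 + c) (m := 2) 2
          (Nat.coprime_two_right.2 (by simpa [Nat.odd_add] using hc2))) (by simp))
      have : (x ^ (1 + c)) ^ 2 = -x ^ 2 := by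
        rw [← pow_mul, show (1 + c) * 2 = 2 + 2 * c by ring, pow_add, hhalf, mul_neg_one]
      rw [this] at e
      exact eq_one_of_parityResultant_neg h15 (pow_ne_zero _ hx0) h1 e
    · have e := hres (2 + c) (Nat.Coprime.mul_right
        (Nat.Coprime.pow_right (k := 2 + c) (m := 2) 2
          (Nat.coprime_two_right.2 (Even.add_odd (by decide) hc2)))
        (by simpa using Nat.coprime_two_left.2 hc2))
      have : (x ^ (2 + c)) ^ 2 = -(x ^ 2) ^ 2 := by
        rw [← pow_mul, show (2 + c) * 2 = 2 * 2 + 2 * c by ring, pow_add, hhalf, mul_neg_one,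
          pow_mul]
      rw [this] at e
      exact eq_one_of_parityResultant_neg_sq h15 (pow_ne_zero _ hx0) h1 e
  obtain ⟨k, hk⟩ := exists_dvd_prime_pow_mul 3 hb hx hx2
  -- Now 4c ∣ 3^k · 2 would force 4 ∣ 2.
  have h4 : Nat.Coprime 4 (3 ^ k) := Nat.Coprime.pow_right _ (by norm_num)
  have := Nat.le_of_dvd (by norm_num) (h4.dvd_of_dvd_mul_left ((dvd_mul_right 4 c).trans hk))
  omega

theorem mainTheorem10 (t b : ℕ) (hb : 3 ≤ b) :
    ¬ (Polynomial.cyclotomic b ℚ ∣ polyR t) := by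
  intro h
  rcases Nat.even_or_odd' b with ⟨o, rfl | rfl⟩
  · rcases Nat.even_or_odd' o with ⟨c, rfl | rfl⟩
    · rw [← mul_assoc] at h
      exact not_dvd_of_four_dvd (by omega) h
    · have := eq_one_of_two_mul_odd ⟨c, rfl⟩ h
      omega
  · have := eq_one_of_odd ⟨o, rfl⟩ h
    omega
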